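/- Let $K$ be a field of characteristic $0$ (for instance $\mathbb R$ or $\mathbb C$) and let $N\ge 1$. Consider evolutionary systems for a scalar unknown $u(x,t)$ and a vector unknown $U(x,t)=(U_1,\dots,U_N)$, write $\langle \partial_x^mU,\partial_x^nU\rangle=\sum_{j=1}^N(\partial_x^mU_j)(\partial_x^nU_j)$, and give $\partial_x^k u$ and $\partial_x^kU_j$ the weight $k+\tfrac12$ (the case $\lambda_1=\lambda_2=\tfrac12$). The general second-order homogeneous system is $$\begin{aligned} u_{t_2}={}& a_1u_{xx}+a_2u^2u_x+a_3u^5+a_4u_x\langle U,U\rangle+a_5u\langle U,U_x\rangle+a_6u^3\langle U,U\rangle+a_7u\langle U,U\rangle^2,\\ U_{t_2}={}& a_8U_{xx}+a_9uu_xU+a_{10}u^2U_x+a_{11}u^4U+a_{12}\langle U,U\rangle U_x+a_{13}\langle U,U_x\rangle U+a_{14}u^2\langle U,U\rangle U+a_{15}\langle U,U\rangle^2U, \end{aligned}\tag{1}$$ with constants $a_i\in K$ such that $(a_1,a_8)\ne(0,0)$, $(a_4,a_5,a_6,a_7)\neq(0,0,0,0)$ and $(a_9,a_{10},a_{11},a_{14})\ne(0,0,0,0)$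 (so that the order is $2$ and the system is not triangular). The general third-order homogeneous system is $$\begin{aligned} u_{t_3}={}& b_1u_{xxx}+b_2u^2u_{xx}+b_3uu_x^2+b_4u^4u_x+b_5u^7+b_6u_{xx}\langle U,U\rangle+b_7u_x\langle U,U_x\rangle+b_8u\langle U_x,U_x\rangle+b_9u\langle U,U_{xx}\rangle\\ &+b_{10}u^2u_x\langle U,U\rangle+b_{11}u^3\langle U,U_x\rangle+b_{12}u^5\langle U,U\rangle+b_{13}u_x\langle U,U\rangle^2+b_{14}u\langle U,U\rangle\langle U,U_x\rangle+b_{15}u^3\langle U,U\rangle^2+b_{16}u\langle U,U\rangle^3,\\ U_{t_3}={}& b_{17}U_{xxx}+b_{18}uu_{xx}U+b_{19}u_x^2U+b_{20}uu_xU_x+b_{21}u^2U_{xx}+b_{22}u^3u_xU+b_{23}u^4U_x+b_{24}u^6U+b_{25}\langle U,U\rangle U_{xx}\\ &+b_{26}\langle U,U_x\rangle U_x+b_{27}\langle U_x,U_x\rangle U+b_{28}\langle U,U_{xx}\rangle U+b_{29}uu_x\langle U,U\rangle U+b_{30}u^2\langle U,U\rangle U_x+b_{31}u^2\langle U,U_x\rangle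 U\\ &+b_{32}u^4\langle U,U\rangle U+b_{33}\langle U,U\rangle^2U_x+b_{34}\langle U,U\rangle\langle U,U_x\rangle U+b_{35}u^2\langle U,U\rangle^2U+b_{36}\langle U,U\rangle^3U, \end{aligned}\tag{2}$$ with constants $b_i\in K$ such that $(b_1,b_{17})\ne(0,0)$, at least one of $b_1,\dots,b_{16}$ is nonzero and at least one of $b_{17},\dots,b_{36}$ is nonzero. A fourth-order homogeneous system is a system $$u_{t_4}=P,\qquad U_{t_4}=\sum_{k=0}^4Q_k\,\partial_x^kU,$$ where $P,Q_0,\dots,Q_4$ are polynomials over $K$ in formal symbols for the derivatives $\partial_x^ku$ and the scalar products $\langle\partial_x^mU,\partial_x^nU\rangle$ $(0\le m\le n)$, $P$ being homogeneous of weight $\tfrac92$ and $Q_k$ homogeneous of weight $4-k$, such that the coefficient of $u_{xxxx}$ in $P$ or the constant $Q_4$ is nonzero, $P\neq0$, and not all $Q_k$ are zero. A system with time $\tau$ is a symmetry of a system with time $t$ if the two flows commute, that is, if $(u_\tau)_t=(u_t)_\tau$ and $(U_\tau)_t=(U_t)_\tau$ hold identically as differential polynomials in $u,U_1,\dots,U_N$.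 Then no system of the form (1) satisfying its constraints has a third-order symmetry of the form (2) satisfying its constraints, and none has a fourth-order homogeneous symmetry. -/

import Mathlib

open MvPolynomial

/-- Jet coordinates of a scalar unknown `u` and a vector unknown `U = (U_1, …, U_N)` in one space
variable: `u k` stands for `∂_x^k u` and `U j k` for `∂_x^k U_j`. -/
inductive JetVar (N : ℕ) : Type
  | u (k : ℕ) : JetVar N
  | U (j : Fin N) (k : ℕ) : JetVar N

/-- Differential polynomials in `u` and `U_1, …, U_N` with constant coefficients in `K`. -/
abbrev DiffPoly (K : Type*) [Field K] (N : ℕ) := MvPolynomial (JetVar N) K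

section Jets

variable (K : Type*) [Field K] (N : ℕ)

/-- The total `x`-derivative. -/
noncomputable def totalD : Derivation K (DiffPoly K N) (DiffPoly K N) :=
  mkDerivation K fun
    | .u k => X (.u (k + 1))
    | .U j k => X (.U j (k + 1))

/-- An evolutionary system `u_t = scalar`, `(U_j)_t = vector j`. -/
structure EvolSystem where
  scalar : DiffPoly K N
  vector : Fin N → DiffPoly K N

variable {K N}

/-- The time derivative of differential polynomials along an evolutionary system: the derivation
with `∂_x^k u ↦ D_x^k (u_t)` and `∂_x^k U_j ↦ D_x^k ((U_j)_t)`. -/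
noncomputable def EvolSystem.timeD (S : EvolSystem K N) :
    Derivation K (DiffPoly K N) (DiffPoly K N) :=
  mkDerivation K fun
    | .u k => (totalD K N)^[k] S.scalar
    | .U j k => (totalD K N)^[k] (S.vector j)

/-- `T` (with time `τ`) is a symmetry of `S` (with time `t`): the two flows commute, that is
`(u_τ)_t = (u_t)_τ` and `(U_τ)_t = (U_t)_τ` hold identically. -/
def EvolSystem.IsSymmetryOf (T S : EvolSystem K N) : Prop :=
  S.timeD T.scalar = T.timeD S.scalar ∧
    ∀ j, S.timeD (T.vector j) = T.timeD (S.vector j)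

/-- `∂_x^k u`. -/
noncomputable def ud (k : ℕ) : DiffPoly K N := X (.u k)

/-- `∂_x^k U_j`. -/
noncomputable def Ud (j : Fin N) (k : ℕ) : DiffPoly K N := X (.U j k)

/-- The scalar product `⟨∂_x^m U, ∂_x^n U⟩`. -/
noncomputable def dotU (m n : ℕ) : DiffPoly K N := ∑ j, X (.U j m) * X (.U j n)

end Jets

section Ansatz

variable {K : Type*} [Field K]

/-- The second-order ansatz for the weights `λ₁ = λ₂ = 1/2`, with coefficients `a 1, …, a 15`. -/
noncomputable def secondOrderSystem (N : ℕ) (a : ℕ → K) : EvolSystem K N where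
  scalar :=
    C (a 1) * ud 2 + C (a 2) * ud 0 ^ 2 * ud 1 + C (a 3) * ud 0 ^ 5
    + C (a 4) * ud 1 * dotU 0 0 + C (a 5) * ud 0 * dotU 0 1
    + C (a 6) * ud 0 ^ 3 * dotU 0 0 + C (a 7) * ud 0 * dotU 0 0 ^ 2
  vector := fun j =>
    C (a 8) * Ud j 2 + C (a 9) * ud 0 * ud 1 * Ud j 0 + C (a 10) * ud 0 ^ 2 * Ud j 1
    + C (a 11) * ud 0 ^ 4 * Ud j 0 + C (a 12) * dotU 0 0 * Ud j 1
    + C (a 13) * dotU 0 1 * Ud j 0 + C (a 14) * ud 0 ^ 2 * dotU 0 0 * Ud j 0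
    + C (a 15) * dotU 0 0 ^ 2 * Ud j 0

/-- The second-order system has order two and is not triangular. -/
def SecondOrderAdmissible (a : ℕ → K) : Prop :=
  (a 1 ≠ 0 ∨ a 8 ≠ 0) ∧
  (a 4 ≠ 0 ∨ a 5 ≠ 0 ∨ a 6 ≠ 0 ∨ a 7 ≠ 0) ∧
  (a 9 ≠ 0 ∨ a 10 ≠ 0 ∨ a 11 ≠ 0 ∨ a 14 ≠ 0)

/-- The third-order ansatz for the weights `λ₁ = λ₂ = 1/2`, with coefficients `b 1, …, b 36`. -/
noncomputable def thirdOrderSystem (N : ℕ) (b : ℕ → K) : EvolSystem K N where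
  scalar :=
    C (b 1) * ud 3 + C (b 2) * ud 0 ^ 2 * ud 2 + C (b 3) * ud 0 * ud 1 ^ 2
    + C (b 4) * ud 0 ^ 4 * ud 1 + C (b 5) * ud 0 ^ 7 + C (b 6) * ud 2 * dotU 0 0
    + C (b 7) * ud 1 * dotU 0 1 + C (b 8) * ud 0 * dotU 1 1
    + C (b 9) * ud 0 * dotU 0 2 + C (b 10) * ud 0 ^ 2 * ud 1 * dotU 0 0
    + C (b 11) * ud 0 ^ 3 * dotU 0 1 + C (b 12) * ud 0 ^ 5 * dotU 0 0
    + C (b 13) * ud 1 * dotU 0 0 ^ 2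
    + C (b 14) * ud 0 * dotU 0 0 * dotU 0 1
    + C (b 15) * ud 0 ^ 3 * dotU 0 0 ^ 2 + C (b 16) * ud 0 * dotU 0 0 ^ 3
  vector := fun j =>
    C (b 17) * Ud j 3 + C (b 18) * ud 0 * ud 2 * Ud j 0 + C (b 19) * ud 1 ^ 2 * Ud j 0
    + C (b 20) * ud 0 * ud 1 * Ud j 1 + C (b 21) * ud 0 ^ 2 * Ud j 2
    + C (b 22) * ud 0 ^ 3 * ud 1 * Ud j 0 + C (b 23) * ud 0 ^ 4 * Ud j 1
    + C (b 24) * ud 0 ^ 6 * Ud j 0 + C (b 25) * dotU 0 0 * Ud j 2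
    + C (b 26) * dotU 0 1 * Ud j 1
    + C (b 27) * dotU 1 1 * Ud j 0
    + C (b 28) * dotU 0 2 * Ud j 0 + C (b 29) * ud 0 * ud 1 * dotU 0 0 * Ud j 0
    + C (b 30) * ud 0 ^ 2 * dotU 0 0 * Ud j 1 + C (b 31) * ud 0 ^ 2 * dotU 0 1 * Ud j 0
    + C (b 32) * ud 0 ^ 4 * dotU 0 0 * Ud j 0
    + C (b 33) * dotU 0 0 ^ 2 * Ud j 1
    + C (b 34) * dotU 0 0 * dotU 0 1 * Ud j 0 + C (b 35) * ud 0 ^ 2 * dotU 0 0 ^ 2 * Ud j 0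
    + C (b 36) * dotU 0 0 ^ 3 * Ud j 0

/-- The third-order symmetry has order three, and neither right-hand side is zero. -/
def ThirdOrderAdmissible (b : ℕ → K) : Prop :=
  (b 1 ≠ 0 ∨ b 17 ≠ 0) ∧
  (∃ i ∈ Finset.Icc 1 16, b i ≠ 0) ∧
  (∃ i ∈ Finset.Icc 17 36, b i ≠ 0)

/-- Formal generators of the scalar expressions built from `u` and scalar products of `U`:
`u k` stands for `∂_x^k u`, and `dot m d` for `⟨∂_x^m U, ∂_x^(m+d) U⟩`. Every scalar product of
derivatives of `U` is listed exactly once. -/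
inductive ScalarGen : Type
  | u (k : ℕ) : ScalarGen
  | dot (m d : ℕ) : ScalarGen

/-- Twice the weight of a generator for `λ₁ = λ₂ = 1/2`: `∂_x^k u` and `∂_x^k U` have weight
`k + 1/2`. -/
def ScalarGen.twiceWeight : ScalarGen → ℕ
  | .u k => 2 * k + 1
  | .dot m d => (2 * m + 1) + (2 * (m + d) + 1)

/-- The value of a formal scalar expression for an `N`-component vector `U`. -/
noncomputable def scalarEval (N : ℕ) : MvPolynomial ScalarGen K →ₐ[K] DiffPoly K N :=
  aeval fun
    | .u k => ud k
    | .dot m d => dotU m (m + d)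

/-- The general homogeneous ansatz of weight `μ` for `λ₁ = λ₂ = 1/2`: `u_t = scalar` has weight
`μ + 1/2`, and `U_t = ∑_{k ≤ μ} vector k * ∂_x^k U`, where `vector k` has weight `μ - k`. -/
structure HomogeneousAnsatz (K : Type*) [Field K] (μ : ℕ) where
  scalar : MvPolynomial ScalarGen K
  vector : Fin (μ + 1) → MvPolynomial ScalarGen K
  scalar_hom : IsWeightedHomogeneous ScalarGen.twiceWeight scalar (2 * μ + 1)
  vector_hom : ∀ k, IsWeightedHomogeneous ScalarGen.twiceWeight (vector k) (2 * (μ - (k : ℕ)))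

/-- The evolutionary system of a homogeneous ansatz, for an `N`-component vector `U`. -/
noncomputable def HomogeneousAnsatz.toSystem {μ : ℕ} (A : HomogeneousAnsatz K μ) (N : ℕ) :
    EvolSystem K N where
  scalar := scalarEval N A.scalar
  vector := fun j => ∑ k : Fin (μ + 1), scalarEval N (A.vector k) * Ud j k

/-- The ansatz has differential order `μ` (by homogeneity, `∂_x^μ u` and `∂_x^μ U` can only occur
linearly, in the scalar and the vector equation respectively), and neither right-hand side is
zero. -/
def HomogeneousAnsatz.Admissible {μ : ℕ} (A : HomogeneousAnsatz K μ) : Prop :=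
  (A.scalar.coeff (Finsupp.single (ScalarGen.u μ) 1) ≠ 0 ∨
    (A.vector (Fin.last μ)).coeff 0 ≠ 0) ∧
  A.scalar ≠ 0 ∧ (∃ k, A.vector k ≠ 0)

end Ansatz

/-! Both flows preserve the vectors `U` with a single nonzero component, so it suffices to study two
scalar unknowns; no coupling coefficient is lost there. Write `c` for one unknown and `!c` for the
other, and replace differential polynomials by their symbols at exponential modes `e^{kx}`.

Let the linear parts be `α c ∂²` and `β c ∂^μ`. Commutation at the modes `x` of `c` and `y, z` of
`!c` says that the cubic symbol of the system times `β c ((x+y+z)^μ - x^μ) - β (!c) (y^μ + z^μ)`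
equals the cubic symbol of the symmetry times the same form with `α` and exponent 2
(`symb_three_of_commute`). If `α (!c) ≠ 0`, the order-`μ` form, for `μ = 3, 4`, is not identically
zero on the zeros of the quadratic one, and this forces the linear cubic symbol to vanish
(`eq_zero_of_vanish_on_resonance`). The cubic symbol of the symmetry then vanishes too, so no
products of cubic symbols enter at degree five, and the same argument kills the quintic couplings
(`pairSystem_coeff_eq_zero`). The equation of `c` is thus decoupled, against non-triangularity. -/

section TwoFields

/-! ### Symbolic calculus for two scalar unknowns -/

variable {R : Type*} [CommRing R]

/-- The total `x`-derivative for two scalar unknowns indexed by `Bool`, where `X (c, k)` stands for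
the `k`-th derivative of the unknown `c`. -/
noncomputable def pairD (R : Type*) [CommRing R] :
    Derivation R (MvPolynomial (Bool × ℕ) R) (MvPolynomial (Bool × ℕ) R) :=
  mkDerivation R fun i => X (i.1, i.2 + 1)

/-- The operator `D_x + r`. -/
noncomputable def shiftD (r : R) (P : MvPolynomial (Bool × ℕ) R) : MvPolynomial (Bool × ℕ) R :=
  pairD R P + C r * P

/-- The derivation sending the `k`-th derivative of the unknown `c` to `(D_x + r)^k (f c)`; for
`r = 0` it is the time derivative along the evolutionary system `f`. -/
noncomputable def flow (r : R) (f : Bool → MvPolynomial (Bool × ℕ) R) :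
    Derivation R (MvPolynomial (Bool × ℕ) R) (MvPolynomial (Bool × ℕ) R) :=
  mkDerivation R fun i => (shiftD r)^[i.2] (f i.1)

/-- The variational derivative in the direction of the exponential mode `e^{m.2 x}` of the unknown
`m.1`. -/
noncomputable def modeD (m : Bool × R) :
    Derivation R (MvPolynomial (Bool × ℕ) R) (MvPolynomial (Bool × ℕ) R) :=
  mkDerivation R fun i => if i.1 = m.1 then C (m.2 ^ i.2) else 0

/-- The symbol of a differential polynomial at a list of exponential modes. -/
noncomputable def symb (P : MvPolynomial (Bool × ℕ) R) (J : List (Bool × R)) : R :=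
  constantCoeff (J.foldl (fun Q m => modeD m Q) P)

@[simp] theorem pairD_X (i : Bool × ℕ) : pairD R (X i) = X (i.1, i.2 + 1) := mkDerivation_X ..

@[simp] theorem pairD_C (r : R) : pairD R (C r) = 0 := derivation_C _ _

@[simp] theorem flow_X (r : R) (f : Bool → MvPolynomial (Bool × ℕ) R) (i : Bool × ℕ) :
    flow r f (X i) = (shiftD r)^[i.2] (f i.1) := mkDerivation_X ..

@[simp] theorem flow_C (r s : R) (f : Bool → MvPolynomial (Bool × ℕ) R) :
    flow r f (C s) = 0 := derivation_C _ _

@[simp] theorem modeD_X (m : Bool × R) (i : Bool × ℕ) :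
    modeD m (X i) = if i.1 = m.1 then C (m.2 ^ i.2) else 0 := mkDerivation_X ..

@[simp] theorem modeD_C (m : Bool × R) (s : R) : modeD m (C s) = 0 := derivation_C _ _

/-- Varying along `e^{kx}` gives `e^{kx} Q`, and `D_x (e^{kx} Q) = e^{kx} (D_x + k) Q`; with the
exponential dropped, this is the shift. Both sides come from derivations, so generators suffice. -/
theorem modeD_pairD (m : Bool × R) (P : MvPolynomial (Bool × ℕ) R) :
    modeD m (pairD R P) = shiftD m.2 (modeD m P) := by
  have h : ⁅modeD m, pairD R⁆ = (C m.2 : MvPolynomial (Bool × ℕ) R) • modeD m := by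
    refine derivation_ext fun i => ?_
    rw [Derivation.commutator_apply, Derivation.smul_apply, pairD_X, modeD_X, modeD_X]
    split_ifs <;> simp [pow_succ', *]
  have := congrArg (fun E => E P) h
  rw [Derivation.commutator_apply, Derivation.smul_apply] at this
  rw [shiftD, ← smul_eq_mul, ← this]
  ring

theorem modeD_shiftD (m : Bool × R) (r : R) (P : MvPolynomial (Bool × ℕ) R) :
    modeD m (shiftD r P) = shiftD (r + m.2) (modeD m P) := by
  simp only [shiftD, map_add, modeD_pairD, Derivation.leibniz, modeD_C, smul_eq_mul]
  ring

theorem modeD_iterate_shiftD (m : Bool × R) (r : R) (k : ℕ) (P : MvPolynomial (Bool × ℕ) R) :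
    modeD m ((shiftD r)^[k] P) = (shiftD (r + m.2))^[k] (modeD m P) := by
  induction k generalizing P with
  | zero => rfl
  | succ k ih => rw [Function.iterate_succ_apply, ih, modeD_shiftD, Function.iterate_succ_apply]

/-- Product rule for varying a flow. The varied right-hand side carries an exponential, which is why
flows with a shift `r` are needed: they form a class closed under variation, and `symb_flow` follows
by induction on the modes. -/
theorem modeD_flow (m : Bool × R) (r : R) (f : Bool → MvPolynomial (Bool × ℕ) R)
    (P : MvPolynomial (Bool × ℕ) R) :
    modeD m (flow r f P)
      = flow r f (modeD m P) + flow (r + m.2) (fun c => modeD m (f c)) P := by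
  have h : ⁅modeD m, flow r f⁆ = flow (r + m.2) (fun c => modeD m (f c)) := by
    refine derivation_ext fun i => ?_
    rw [Derivation.commutator_apply, flow_X, flow_X, modeD_X, modeD_iterate_shiftD]
    split_ifs <;> simp
  rw [← h, Derivation.commutator_apply]
  ring

theorem constantCoeff_pairD (P : MvPolynomial (Bool × ℕ) R) : constantCoeff (pairD R P) = 0 := by
  induction P using MvPolynomial.induction_on with
  | C a => simp
  | add p q hp hq => simp [hp, hq]
  | mul_X p i hp => simp [Derivation.leibniz, hp]

theorem constantCoeff_iterate_shiftD (r : R) (k : ℕ) (P : MvPolynomial (Bool × ℕ) R) :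
    constantCoeff ((shiftD r)^[k] P) = r ^ k * constantCoeff P := by
  induction k with
  | zero => simp
  | succ k ih =>
    rw [Function.iterate_succ_apply', shiftD, map_add, constantCoeff_pairD, map_mul, ih,
      constantCoeff_C]
    ring

theorem constantCoeff_flow (r : R) (f : Bool → MvPolynomial (Bool × ℕ) R)
    (P : MvPolynomial (Bool × ℕ) R) :
    constantCoeff (flow r f P) = ∑ c, constantCoeff (f c) * symb P [(c, r)] := by
  simp only [symb, List.foldl]
  induction P using MvPolynomial.induction_on with
  | C a => simp
  | add p q hp hq => simp only [map_add, hp, hq, mul_add, Finset.sum_add_distrib]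
  | mul_X p i hp =>
    obtain ⟨c, k⟩ := i
    simp only [Derivation.leibniz, map_add, smul_eq_mul, map_mul, constantCoeff_X, zero_mul,
      add_zero, flow_X, constantCoeff_iterate_shiftD, modeD_X]
    cases c <;> simp <;> ring

/-- All splittings of a list into a sublist and its complement. -/
def splits {α : Type*} : List α → List (List α × List α)
  | [] => [([], [])]
  | m :: J => (splits J).map (fun p => (p.1, m :: p.2)) ++ (splits J).map (fun p => (m :: p.1, p.2))

/-- The symbol of the time derivative of `P` in terms of the symbols of `P` and of the system. -/
theorem symb_flow (J : List (Bool × R)) (r : R) (f : Bool → MvPolynomial (Bool × ℕ) R)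
    (P : MvPolynomial (Bool × ℕ) R) :
    symb (flow r f P) J = ((splits J).map fun p => ∑ c, symb (f c) p.1 *
      symb P (p.2 ++ [(c, r + (p.1.map Prod.snd).sum)])).sum := by
  induction J generalizing r f P with
  | nil => simpa [splits, symb] using constantCoeff_flow r f P
  | cons m J ih =>
    have hadd : ∀ (J : List (Bool × R)) (P Q : MvPolynomial (Bool × ℕ) R),
        symb (P + Q) J = symb P J + symb Q J := by
      intro J
      induction J with
      | nil => intro P Q; simp [symb]
      | cons m J ih =>
        intro P Q
        have := ih (modeD m P) (modeD m Q)
        simpa [symb] using this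
    have hc : ∀ (Q : MvPolynomial (Bool × ℕ) R) I, symb Q (m :: I) = symb (modeD m Q) I :=
      fun _ _ => rfl
    rw [hc, modeD_flow, hadd, ih, ih]
    simp [splits, hc, Function.comp_def, add_assoc]

theorem modeD_comm (m n : Bool × R) (P : MvPolynomial (Bool × ℕ) R) :
    modeD m (modeD n P) = modeD n (modeD m P) := by
  have h : ⁅modeD m, modeD n⁆ = 0 := by
    refine derivation_ext fun i => ?_
    rw [Derivation.commutator_apply, modeD_X, modeD_X]
    split_ifs <;> simp
  have := congrArg (fun E => E P) h
  rwa [Derivation.commutator_apply, Derivation.zero_apply, sub_eq_zero] at this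

theorem symb_perm (P : MvPolynomial (Bool × ℕ) R) {J J' : List (Bool × R)} (h : J.Perm J') :
    symb P J = symb P J' := by
  have : RightCommutative fun (Q : MvPolynomial (Bool × ℕ) R) (m : Bool × R) => modeD m Q :=
    ⟨fun Q m n => modeD_comm n m Q⟩
  rw [symb, symb, h.foldl_eq]

theorem symb_cons (P : MvPolynomial (Bool × ℕ) R) (m : Bool × R) (J : List (Bool × R)) :
    symb P (m :: J) = symb (modeD m P) J := rfl

theorem symb_neg (P : MvPolynomial (Bool × ℕ) R) (J : List (Bool × R)) :
    symb (-P) J = -symb P J := by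
  induction J generalizing P with
  | nil => simp [symb]
  | cons m J ih => rw [symb_cons, symb_cons, map_neg, ih]

theorem symb_aeval_neg (P : MvPolynomial (Bool × ℕ) R) (J : List (Bool × R)) :
    symb (aeval (fun i => -X i) P) J = (-1) ^ J.length * symb P J := by
  induction J generalizing P with
  | nil =>
    simp only [symb, List.foldl, List.length_nil, pow_zero, one_mul]
    induction P using MvPolynomial.induction_on with
    | C a => simp
    | add p q hp hq => simp only [map_add, hp, hq]
    | mul_X p i hp => simp
  | cons m J ih =>
    have h : modeD m (aeval (fun i => -X i) P) = -aeval (fun i => -X i) (modeD m P) := by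
      induction P using MvPolynomial.induction_on with
      | C a => simp
      | add p q hp hq => simp only [map_add, hp, hq, neg_add]
      | mul_X p i hp =>
        simp only [map_mul, aeval_X, Derivation.leibniz, map_neg, modeD_X, smul_eq_mul, hp, map_add]
        split_ifs <;> simp
        ring
    rw [symb_cons, symb_cons, h, symb_neg, ih, List.length_cons, pow_succ]
    ring

/-- The second-order system with weights `1/2` for two scalar unknowns. -/
noncomputable def pairSystem (α : Bool → R) (p : Fin 6 → Bool → R) (c : Bool) :
    MvPolynomial (Bool × ℕ) R :=
  C (α c) * X (c, 2) + C (p 0 c) * X (c, 0) ^ 2 * X (c, 1) + C (p 1 c) * X (c, 0) ^ 5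
    + C (p 2 c) * X (c, 1) * X (!c, 0) ^ 2 + C (p 3 c) * X (c, 0) * (X (!c, 0) * X (!c, 1))
    + C (p 4 c) * X (c, 0) ^ 3 * X (!c, 0) ^ 2 + C (p 5 c) * X (c, 0) * X (!c, 0) ^ 4

/-! ### Symbols of the second-order pair system -/

section Symbols

variable (α : Bool → R) (p : Fin 6 → Bool → R) (c : Bool)

theorem symb_pairSystem_one (c₁ : Bool) (x : R) :
    symb (pairSystem α p c) [(c₁, x)] = if c = c₁ then α c * x ^ 2 else 0 := by
  cases c <;> cases c₁ <;>
  simp [symb, pairSystem, Derivation.leibniz, pow_succ]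

theorem symb_pairSystem_three (x y z : R) :
    symb (pairSystem α p c) [(c, x), (!c, y), (!c, z)] = 2 * p 2 c * x + p 3 c * (y + z) := by
  cases c <;>
  simp [symb, pairSystem, Derivation.leibniz, pow_succ] <;> ring

/-- The equation of `c` is odd in the unknown `c` and even in `!c`; the exclusive or detects this
parity. -/
theorem symb_pairSystem_three_of_ne (c₁ c₂ c₃ : Bool) (x y z : R)
    (h : ((c₁ ^^ c₂) ^^ c₃) ≠ c) :
    symb (pairSystem α p c) [(c₁, x), (c₂, y), (c₃, z)] = 0 := by
  revert h
  cases c <;> cases c₁ <;> cases c₂ <;> cases c₃ <;>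
  simp [symb, pairSystem, Derivation.leibniz, pow_succ]

/-- The system is odd under a simultaneous sign change of both unknowns. Hence even symbols of the
symmetry, about which nothing is assumed, never contribute below. -/
theorem symb_pairSystem_of_even [NoZeroDivisors R] [CharZero R] {J : List (Bool × R)}
    (hJ : Even J.length) : symb (pairSystem α p c) J = 0 := by
  have h := symb_aeval_neg (pairSystem α p c) J
  rw [hJ.neg_one_pow, one_mul] at h
  have h' : aeval (fun i => -X i) (pairSystem α p c) = -pairSystem α p c := by
    simp only [pairSystem, map_add, map_mul, map_pow, aeval_X, algHom_C, algebraMap_eq]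
    ring
  rw [h', symb_neg] at h
  exact self_eq_neg.1 h.symm

theorem symb_pairSystem_one_four (x y z t w : R) :
    symb (pairSystem α p c) [(c, x), (!c, y), (!c, z), (!c, t), (!c, w)] = 24 * p 5 c := by
  cases c <;>
  simp [symb, pairSystem, Derivation.leibniz, pow_succ] <;> ring

theorem symb_pairSystem_three_two (x y z t w : R) :
    symb (pairSystem α p c) [(c, x), (c, y), (c, z), (!c, t), (!c, w)] = 12 * p 4 c := by
  cases c <;>
  simp [symb, pairSystem, Derivation.leibniz, pow_succ] <;> ring

end Symbols

theorem symb_rotate_cons (P : MvPolynomial (Bool × ℕ) R) (I J : List (Bool × R)) (m : Bool × R) :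
    symb P (I ++ (J ++ [m])) = symb P (I ++ m :: J) :=
  symb_perm P ((List.perm_append_singleton m J).append_left I)

/-! ### Commutation at degrees three and five -/

section Commuting

variable [NoZeroDivisors R] [CharZero R] {α β : Bool → R} {p : Fin 6 → Bool → R} {μ : ℕ}
  {g : Bool → MvPolynomial (Bool × ℕ) R} {c : Bool}

theorem symb_three_of_commute
    (hlin : ∀ c c' x, symb (g c) [(c', x)] = if c = c' then β c * x ^ μ else 0)
    (h : flow 0 (pairSystem α p) (g c) = flow 0 g (pairSystem α p c)) (x y z : R) :
    (2 * p 2 c * x + p 3 c * (y + z)) *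
        (β c * ((x + (y + z)) ^ μ - x ^ μ) - β (!c) * (y ^ μ + z ^ μ))
      = symb (g c) [(c, x), (!c, y), (!c, z)] *
        (α c * ((x + (y + z)) ^ 2 - x ^ 2) - α (!c) * (y ^ 2 + z ^ 2)) := by
  have h1 := congrArg (fun P => symb P [(c, x), (!c, y), (!c, z)]) h
  -- When the linear symbol acts on one mode, `symb_flow` moves that mode to the end of the list;
  -- these equalities restore the order. The last mode needs none.
  have q1 (P) := symb_rotate_cons P [] [(!c, y), (!c, z)] (c, x)
  have q2 (P) := symb_rotate_cons P [(c, x)] [(!c, z)] (!c, y)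
  have s := symb_pairSystem_three α p c x y z
  have e0 (c : Bool) : symb (pairSystem α p c) [] = 0 := symb_pairSystem_of_even _ _ _ (by simp)
  have e2 (c : Bool) (m₁ m₂) : symb (pairSystem α p c) [m₁, m₂] = 0 :=
    symb_pairSystem_of_even _ _ _ (by simp)
  have e4 (c : Bool) (m₁ m₂ m₃ m₄) : symb (pairSystem α p c) [m₁, m₂, m₃, m₄] = 0 :=
    symb_pairSystem_of_even _ _ _ (by simp [parity_simps])
  simp only [symb_flow, splits, List.map_cons, List.map_nil, List.cons_append, List.nil_append,
    List.sum_cons, List.sum_nil, add_zero, zero_add, Fintype.sum_bool] at h1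
  cases c <;>
  simp [hlin, e0, e2, e4, symb_pairSystem_one, symb_pairSystem_three_of_ne] at h1 q1 q2 s ⊢ <;>
  simp only [q1, q2, s] at h1 <;> linear_combination h1

/-- A splitting into two cubic symbols contributes nothing: by parity, each product contains a cubic
coupling symbol of equation `c`, of the system or of the symmetry, or a symbol zero by parity. Only
linear times quintic remains. -/
theorem symb_one_four_of_commute
    (hlin : ∀ c c' x, symb (g c) [(c', x)] = if c = c' then β c * x ^ μ else 0)
    (h : flow 0 (pairSystem α p) (g c) = flow 0 g (pairSystem α p c))
    (hp₂ : p 2 c = 0) (hp₃ : p 3 c = 0)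
    (hg : ∀ x y z, symb (g c) [(c, x), (!c, y), (!c, z)] = 0) (x y z t w : R) :
    24 * p 5 c * (β c * ((x + (y + (z + (t + w)))) ^ μ - x ^ μ)
        - β (!c) * (y ^ μ + z ^ μ + t ^ μ + w ^ μ))
      = symb (g c) [(c, x), (!c, y), (!c, z), (!c, t), (!c, w)] *
        (α c * ((x + (y + (z + (t + w)))) ^ 2 - x ^ 2)
          - α (!c) * (y ^ 2 + z ^ 2 + t ^ 2 + w ^ 2)) := by
  have h1 := congrArg (fun P => symb P [(c, x), (!c, y), (!c, z), (!c, t), (!c, w)]) h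
  have q1 (P) := symb_rotate_cons P [] [(!c, y), (!c, z), (!c, t), (!c, w)] (c, x)
  have q2 (P) := symb_rotate_cons P [(c, x)] [(!c, z), (!c, t), (!c, w)] (!c, y)
  have q3 (P) := symb_rotate_cons P [(c, x), (!c, y)] [(!c, t), (!c, w)] (!c, z)
  have q4 (P) := symb_rotate_cons P [(c, x), (!c, y), (!c, z)] [(!c, w)] (!c, t)
  have hg' (x y z) := (symb_rotate_cons (g c) [] [(!c, y), (!c, z)] (c, x)).trans (hg x y z)
  have s := symb_pairSystem_one_four α p c x y z t w
  have s3 (x y z) := symb_pairSystem_three α p c x y z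
  have s3' (x y z) := symb_rotate_cons (pairSystem α p c) [] [(!c, y), (!c, z)] (c, x)
  have e0 (c : Bool) : symb (pairSystem α p c) [] = 0 := symb_pairSystem_of_even _ _ _ (by simp)
  have e2 (c : Bool) (m₁ m₂) : symb (pairSystem α p c) [m₁, m₂] = 0 :=
    symb_pairSystem_of_even _ _ _ (by simp)
  have e4 (c : Bool) (m₁ m₂ m₃ m₄) : symb (pairSystem α p c) [m₁, m₂, m₃, m₄] = 0 :=
    symb_pairSystem_of_even _ _ _ (by simp [parity_simps])
  have e6 (c : Bool) (m₁ m₂ m₃ m₄ m₅ m₆) :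
      symb (pairSystem α p c) [m₁, m₂, m₃, m₄, m₅, m₆] = 0 :=
    symb_pairSystem_of_even _ _ _ (by simp [parity_simps])
  simp only [symb_flow, splits, List.map_cons, List.map_nil, List.cons_append, List.nil_append,
    List.sum_cons, List.sum_nil, add_zero, zero_add, Fintype.sum_bool] at h1
  cases c <;>
  simp [hp₂, hp₃] at q1 q2 q3 q4 s s3 s3' hg hg' ⊢ <;>
  simp [hlin, hg, hg', s3, s3', e0, e2, e4, e6, symb_pairSystem_one,
    symb_pairSystem_three_of_ne] at h1 <;>
  simp only [q1, q2, q3, q4, s] at h1 <;> linear_combination h1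

theorem symb_three_two_of_commute
    (hlin : ∀ c c' x, symb (g c) [(c', x)] = if c = c' then β c * x ^ μ else 0)
    (h : flow 0 (pairSystem α p) (g c) = flow 0 g (pairSystem α p c))
    (hp₂ : p 2 c = 0) (hp₃ : p 3 c = 0)
    (hg : ∀ x y z, symb (g c) [(c, x), (!c, y), (!c, z)] = 0) (x y z t w : R) :
    12 * p 4 c * (β c * ((x + (y + (z + (t + w)))) ^ μ - (x ^ μ + y ^ μ + z ^ μ))
        - β (!c) * (t ^ μ + w ^ μ))
      = symb (g c) [(c, x), (c, y), (c, z), (!c, t), (!c, w)] *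
        (α c * ((x + (y + (z + (t + w)))) ^ 2 - (x ^ 2 + y ^ 2 + z ^ 2))
          - α (!c) * (t ^ 2 + w ^ 2)) := by
  have h1 := congrArg (fun P => symb P [(c, x), (c, y), (c, z), (!c, t), (!c, w)]) h
  have q1 (P) := symb_rotate_cons P [] [(c, y), (c, z), (!c, t), (!c, w)] (c, x)
  have q2 (P) := symb_rotate_cons P [(c, x)] [(c, z), (!c, t), (!c, w)] (c, y)
  have q3 (P) := symb_rotate_cons P [(c, x), (c, y)] [(!c, t), (!c, w)] (c, z)
  have q4 (P) := symb_rotate_cons P [(c, x), (c, y), (c, z)] [(!c, w)] (!c, t)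
  have hg' (x y z) := (symb_rotate_cons (g c) [] [(!c, y), (!c, z)] (c, x)).trans (hg x y z)
  have s := symb_pairSystem_three_two α p c x y z t w
  have s3 (x y z) := symb_pairSystem_three α p c x y z
  have s3' (x y z) := symb_rotate_cons (pairSystem α p c) [] [(!c, y), (!c, z)] (c, x)
  have e0 (c : Bool) : symb (pairSystem α p c) [] = 0 := symb_pairSystem_of_even _ _ _ (by simp)
  have e2 (c : Bool) (m₁ m₂) : symb (pairSystem α p c) [m₁, m₂] = 0 :=
    symb_pairSystem_of_even _ _ _ (by simp)
  have e4 (c : Bool) (m₁ m₂ m₃ m₄) : symb (pairSystem α p c) [m₁, m₂, m₃, m₄] = 0 :=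
    symb_pairSystem_of_even _ _ _ (by simp [parity_simps])
  have e6 (c : Bool) (m₁ m₂ m₃ m₄ m₅ m₆) :
      symb (pairSystem α p c) [m₁, m₂, m₃, m₄, m₅, m₆] = 0 :=
    symb_pairSystem_of_even _ _ _ (by simp [parity_simps])
  simp only [symb_flow, splits, List.map_cons, List.map_nil, List.cons_append, List.nil_append,
    List.sum_cons, List.sum_nil, add_zero, zero_add, Fintype.sum_bool] at h1
  cases c <;>
  simp [hp₂, hp₃] at q1 q2 q3 q4 s s3 s3' hg hg' ⊢ <;>
  simp [hlin, hg, hg', s3, s3', e0, e2, e4, e6, symb_pairSystem_one,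
    symb_pairSystem_three_of_ne] at h1 <;>
  simp only [q1, q2, q3, q4, s] at h1 <;> linear_combination h1

end Commuting

end TwoFields

/-! ### Extension of scalars and the resonance argument -/

section TwoFields

section BaseChange

variable {R S : Type*} [CommRing R] [CommRing S] (φ : R →+* S)

theorem map_pairD (P : MvPolynomial (Bool × ℕ) R) :
    map φ (pairD R P) = pairD S (map φ P) := by
  induction P using MvPolynomial.induction_on with
  | C a => simp
  | add p q hp hq => simp only [map_add, hp, hq]
  | mul_X p i hp => simp [Derivation.leibniz, hp]

theorem map_iterate_shiftD (r : R) (k : ℕ) (P : MvPolynomial (Bool × ℕ) R) :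
    map φ ((shiftD r)^[k] P) = (shiftD (φ r))^[k] (map φ P) :=
  (Function.Semiconj.iterate_right
    (fun P => by simp [shiftD, map_pairD] : Function.Semiconj (map φ) (shiftD r) (shiftD (φ r)))
    k).eq P

theorem map_flow (r : R) (f : Bool → MvPolynomial (Bool × ℕ) R) (P : MvPolynomial (Bool × ℕ) R) :
    map φ (flow r f P) = flow (φ r) (fun c => map φ (f c)) (map φ P) := by
  induction P using MvPolynomial.induction_on with
  | C a => simp
  | add p q hp hq => simp only [map_add, hp, hq]
  | mul_X p i hp => simp [Derivation.leibniz, hp, map_iterate_shiftD]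

theorem map_modeD (m : Bool × R) (P : MvPolynomial (Bool × ℕ) R) :
    map φ (modeD m P) = modeD (m.1, φ m.2) (map φ P) := by
  induction P using MvPolynomial.induction_on with
  | C a => simp
  | add p q hp hq => simp only [map_add, hp, hq]
  | mul_X p i hp =>
    simp only [map_mul, map_X, Derivation.leibniz, map_add, smul_eq_mul, hp, modeD_X]
    split_ifs <;> simp

theorem symb_map (P : MvPolynomial (Bool × ℕ) R) (J : List (Bool × R)) :
    symb (map φ P) (J.map fun m => (m.1, φ m.2)) = φ (symb P J) := by
  induction J generalizing P with
  | nil => simp [symb, constantCoeff_map]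
  | cons m J ih => rw [List.map_cons, symb_cons, symb_cons, ← map_modeD, ih]

theorem map_pairSystem (α : Bool → R) (p : Fin 6 → Bool → R) (c : Bool) :
    map φ (pairSystem α p c) = pairSystem (fun c => φ (α c)) (fun i c => φ (p i c)) c := by
  simp [pairSystem]

end BaseChange

/-- On the slice `y + z = 1` the quadratic form vanishes exactly when `y² + z² = (a/a')(1 + 2x)`.
Over an algebraically closed field this is solvable for every `x`, and the hypothesis becomes a
polynomial identity in `x` alone. -/
theorem eq_zero_of_vanish_on_resonance {L : Type*} [Field L] [IsAlgClosed L] [CharZero L]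
    {μ : ℕ} (hμ : μ = 3 ∨ μ = 4) {a a' b b' A B : L} (ha : a' ≠ 0) (hb : b ≠ 0 ∨ b' ≠ 0)
    (h : ∀ x y z : L, a * ((x + (y + z)) ^ 2 - x ^ 2) - a' * (y ^ 2 + z ^ 2) = 0 →
      (2 * A * x + B * (y + z)) * (b * ((x + (y + z)) ^ μ - x ^ μ) - b' * (y ^ μ + z ^ μ)) = 0) :
    A = 0 ∧ B = 0 := by
  have hyz : ∀ x : L, ∃ y z : L, y + z = 1 ∧ y ^ 2 + z ^ 2 = a / a' * (1 + 2 * x) := by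
    intro x
    -- Here `d = y - z`, since `(y - z)² = 2(y² + z²) - (y + z)²`.
    obtain ⟨d, hd⟩ := IsAlgClosed.exists_pow_nat_eq (2 * (a / a' * (1 + 2 * x)) - 1) two_pos
    exact ⟨(1 + d) / 2, (1 - d) / 2, by ring, by linear_combination hd / 2⟩
  obtain ⟨r, hr⟩ : ∃ r, r = a / a' := ⟨_, rfl⟩
  rw [← hr] at hyz
  have hra : a = r * a' := by rw [hr]; field_simp
  -- `G` is the order-`μ` form on the slice, with `y^μ + z^μ` expressed through `q = r(1 + 2x)`. It
  -- is nonzero whatever `r` is: `q = 0` at `x = -1/2`; for `μ = 3`, the values of `q` at `0` and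
  -- `-1` cancel in the sum, and for `μ = 4` the point `-1/2` already gives `b' = 0`.
  have key : ∃ G : Polynomial L, G ≠ 0 ∧
      ∀ x : L, (2 * A * x + B) * G.eval x = 0 := by
    rcases hμ with rfl | rfl
    · refine ⟨.C b * (3 * .X ^ 2 + 3 * .X + 1)
        - .C (b' / 2) * (3 * (.C r * (1 + 2 * .X)) - 1), fun h0 => ?_, fun x => ?_⟩
      · have h1 := congrArg (Polynomial.eval (-1 / 2)) h0
        have h2 := congrArg (Polynomial.eval 0) h0
        have h3 := congrArg (Polynomial.eval (-1)) h0
        simp at h1 h2 h3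
        have hb0 : b = 0 := by linear_combination (2 / 3) * (h2 + h3) - (4 / 3) * h1
        have hb0' : b' = 0 := by linear_combination 2 * h1 - hb0 / 2
        exact hb.elim (fun h => h hb0) (fun h => h hb0')
      · obtain ⟨y, z, h1, h2⟩ := hyz x
        have := h x y z (by rw [h1, h2, hra]; ring)
        have h3 : y ^ 3 + z ^ 3 = (3 * (r * (1 + 2 * x)) - 1) / 2 := by
          obtain rfl : y = 1 - z := by linear_combination h1
          linear_combination (3 / 2) * h2
        rw [h1, h3] at this
        simp [-mul_eq_zero]
        linear_combination this
    · refine ⟨.C b * (4 * .X ^ 3 + 6 * .X ^ 2 + 4 * .X + 1)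
        - .C (b' / 2) * ((.C r * (1 + 2 * .X)) ^ 2 + 2 * (.C r * (1 + 2 * .X)) - 1),
        fun h0 => ?_, fun x => ?_⟩
      · have h1 := congrArg (Polynomial.eval (-1 / 2)) h0
        have h2 := congrArg (Polynomial.eval 0) h0
        simp at h1 h2
        have hb0' : b' = 0 := by linear_combination 2 * h1
        have hb0 : b = 0 := by
          rw [hb0'] at h2
          linear_combination h2
        exact hb.elim (fun h => h hb0) (fun h => h hb0')
      · obtain ⟨y, z, h1, h2⟩ := hyz x
        have := h x y z (by rw [h1, h2, hra]; ring)
        have h3 : y ^ 4 + z ^ 4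
            = ((r * (1 + 2 * x)) ^ 2 + 2 * (r * (1 + 2 * x)) - 1) / 2 := by
          rw [← h2]
          obtain rfl : y = 1 - z := by linear_combination h1
          ring
        rw [h1, h3] at this
        simp [-mul_eq_zero]
        linear_combination this
  obtain ⟨G, hG, hG'⟩ := key
  have hP : (Polynomial.C (2 * A) * .X + .C B) * G = 0 :=
    Polynomial.funext fun x => by simpa using hG' x
  have hP' := (mul_eq_zero.1 hP).resolve_right hG
  have h0 := congrArg (Polynomial.eval 0) hP'
  have h1 := congrArg (Polynomial.eval 1) hP'
  simp at h0 h1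
  exact ⟨by simpa [h0] using h1, h0⟩

universe v

/-- `hlin` is required over every `K`-algebra because symbols are evaluated both in the algebraic
closure, to solve the resonance equation, and in a polynomial ring, to cancel a factor. -/
theorem pairSystem_coeff_eq_zero {K : Type v} [Field K] [CharZero K] {μ : ℕ} (hμ : μ = 3 ∨ μ = 4)
    {α β : Bool → K} {p : Fin 6 → Bool → K} {g : Bool → MvPolynomial (Bool × ℕ) K} {c : Bool}
    (hα : α (!c) ≠ 0) (hβ : β c ≠ 0 ∨ β (!c) ≠ 0)
    (hlin : ∀ (R : Type v) [CommRing R] [Algebra K R] (c c' : Bool) (x : R),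
      symb (map (algebraMap K R) (g c)) [(c', x)]
        = if c = c' then algebraMap K R (β c) * x ^ μ else 0)
    (h : flow 0 (pairSystem α p) (g c) = flow 0 g (pairSystem α p c)) :
    p 2 c = 0 ∧ p 3 c = 0 ∧ p 4 c = 0 ∧ p 5 c = 0 := by
  have hmap (R : Type v) [CommRing R] [Algebra K R] :
      flow 0 (pairSystem (fun c => algebraMap K R (α c)) (fun i c => algebraMap K R (p i c)))
          (map (algebraMap K R) (g c))
        = flow 0 (fun c => map (algebraMap K R) (g c))
          (pairSystem (fun c => algebraMap K R (α c)) (fun i c => algebraMap K R (p i c)) c) := by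
    have := congrArg (map (algebraMap K R)) h
    simpa only [map_flow, map_pairSystem, map_zero] using this
  let L := AlgebraicClosure K
  have : CharZero L := charZero_of_injective_algebraMap (algebraMap K L).injective
  have hα' : algebraMap K L (α (!c)) ≠ 0 := by simpa using hα
  have hβ' : algebraMap K L (β c) ≠ 0 ∨ algebraMap K L (β (!c)) ≠ 0 := by simpa using hβ
  have hcub : p 2 c = 0 ∧ p 3 c = 0 := by
    have := eq_zero_of_vanish_on_resonance (L := L) hμ (a := algebraMap K L (α c))
      (A := algebraMap K L (p 2 c)) (B := algebraMap K L (p 3 c)) hα' hβ' fun x y z hz => by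
        have := symb_three_of_commute (hlin L) (hmap L) x y z
        rw [hz, mul_zero] at this
        exact this
    simpa using this
  obtain ⟨hp₂, hp₃⟩ := hcub
  have hg : ∀ x y z : L,
      symb (map (algebraMap K L) (g c)) [(c, x), (!c, y), (!c, z)] = 0 := by
    intro x y z
    -- Pointwise over `L`, nothing follows at the zeros of the quadratic form. With indeterminate
    -- exponents that form is a nonzero element of a domain, its value at `(0, 1, -1)` being `-2 α
    -- (!c)`; the result is then specialized.
    let T := MvPolynomial (Fin 3) K
    have : CharZero T := charZero_of_injective_algebraMap (C_injective (Fin 3) K)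
    have h1 := symb_three_of_commute (hlin T) (hmap T) (X 0) (X 1) (X 2)
    rw [hp₂, hp₃, map_zero, mul_zero, zero_mul, zero_mul, zero_add, zero_mul, eq_comm,
      mul_eq_zero] at h1
    have h2 := h1.resolve_right fun h0 => by
      have := congrArg (eval ![0, 1, -1]) h0
      simp only [T, algebraMap_eq] at this
      have h2 : (![0, 1, -1] : Fin 3 → K) 2 = -1 := rfl
      norm_num [h2] at this
      exact hα this
    have h3 := symb_map (aeval ![x, y, z] : T →ₐ[K] L).toRingHom
      (map (algebraMap K T) (g c)) [(c, X 0), (!c, X 1), (!c, X 2)]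
    rw [h2, map_map] at h3
    have h4 : (aeval ![x, y, z] : T →ₐ[K] L).toRingHom.comp (algebraMap K T) = algebraMap K L :=
      (aeval ![x, y, z] : T →ₐ[K] L).comp_algebraMap
    rw [h4] at h3
    simpa using h3
  have hμ₀ : μ ≠ 0 := by omega
  refine ⟨hp₂, hp₃, ?_, ?_⟩
  · have := eq_zero_of_vanish_on_resonance (L := L) hμ (a := algebraMap K L (α c))
      (A := 0) (B := algebraMap K L (p 4 c)) hα' hβ' fun x y z hz => by
        -- The quintic symbol is constant, so two exponents may be set to zero, which leaves the
        -- three-mode forms; the factor `y + z` fits the case `A = 0` of the resonance lemma.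
        have := symb_three_two_of_commute (hlin L) (hmap L) (by simp [hp₂]) (by simp [hp₃]) hg
          x 0 0 y z
        simp only [zero_add, add_zero, zero_pow hμ₀, zero_pow two_ne_zero, hz, mul_zero] at this
        linear_combination (y + z) / 12 * this
    simpa using this.2
  · have := eq_zero_of_vanish_on_resonance (L := L) hμ (a := algebraMap K L (α c))
      (A := 0) (B := algebraMap K L (p 5 c)) hα' hβ' fun x y z hz => by
        have := symb_one_four_of_commute (hlin L) (hmap L) (by simp [hp₂]) (by simp [hp₃]) hg
          x y z 0 0
        simp only [add_zero, zero_pow hμ₀, zero_pow two_ne_zero, hz, mul_zero] at this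
        linear_combination (y + z) / 24 * this
    simpa using this.2

end TwoFields

/-! ### Reduction to one component of the vector unknown -/

section Reduction

variable {K : Type*} [Field K] {N : ℕ}

/-- Specialization of the vector unknown to the vectors whose only nonzero component is the
`i`-th one; `u` becomes the unknown `false` and `U_i` the unknown `true`. -/
noncomputable def restrict (i : Fin N) : DiffPoly K N →ₐ[K] MvPolynomial (Bool × ℕ) K :=
  aeval fun
    | .u k => X (false, k)
    | .U j k => if j = i then X (true, k) else 0

variable (i : Fin N)

theorem restrict_X_u (k : ℕ) : restrict (K := K) i (X (.u k)) = X (false, k) := by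
  simp [restrict]

theorem restrict_X_U (j : Fin N) (k : ℕ) :
    restrict (K := K) i (X (.U j k)) = if j = i then X (true, k) else 0 := by
  simp [restrict]

theorem restrict_ud (k : ℕ) : restrict (K := K) i (ud k) = X (false, k) := restrict_X_u i k

theorem restrict_Ud (j : Fin N) (k : ℕ) :
    restrict (K := K) i (Ud j k) = if j = i then X (true, k) else 0 := restrict_X_U i j k

theorem restrict_dotU (m n : ℕ) :
    restrict (K := K) i (dotU m n) = X (true, m) * X (true, n) := by
  simp [dotU, restrict_X_U]

theorem restrict_totalD (P : DiffPoly K N) :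
    restrict i (totalD K N P) = pairD K (restrict i P) := by
  induction P using MvPolynomial.induction_on with
  | C a => simp [totalD, ← algebraMap_eq]
  | add p q hp hq => simp only [map_add, hp, hq]
  | mul_X p v hp =>
    simp only [Derivation.leibniz, smul_eq_mul, map_add, map_mul, hp]
    rcases v with k | ⟨j, k⟩
    · simp [totalD, mkDerivation_X, restrict_X_u]
    · simp only [totalD, mkDerivation_X, restrict_X_U]
      split_ifs <;> simp

/-- The restriction of an evolutionary system to one component of the vector unknown. -/
noncomputable def EvolSystem.toPair (S : EvolSystem K N) (c : Bool) :
    MvPolynomial (Bool × ℕ) K :=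
  if c then restrict i (S.vector i) else restrict i S.scalar

theorem restrict_iterate_totalD (k : ℕ) (P : DiffPoly K N) :
    restrict i ((totalD K N)^[k] P) = (shiftD 0)^[k] (restrict i P) :=
  (Function.Semiconj.iterate_right
    (fun P => by simp [shiftD, restrict_totalD] :
      Function.Semiconj (restrict i) (totalD K N) (shiftD (0 : K))) k).eq P

theorem iterate_shiftD_zero (r : K) (k : ℕ) : (shiftD r)^[k] 0 = 0 :=
  Function.iterate_fixed (by simp [shiftD]) k

/-- The hypothesis `hS` says that the vectors with only the `i`-th component nonzero are invariant
under the flow, so restriction intertwines the two time derivatives. -/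
theorem restrict_timeD {S : EvolSystem K N} (hS : ∀ j ≠ i, restrict i (S.vector j) = 0)
    (P : DiffPoly K N) :
    restrict i (S.timeD P) = flow 0 (S.toPair i) (restrict i P) := by
  induction P using MvPolynomial.induction_on with
  | C a => simp [EvolSystem.timeD, ← algebraMap_eq]
  | add p q hp hq => simp only [map_add, hp, hq]
  | mul_X p v hp =>
    simp only [Derivation.leibniz, smul_eq_mul, map_add, map_mul, hp]
    rcases v with k | ⟨j, k⟩
    · simp [EvolSystem.timeD, mkDerivation_X, restrict_X_u, restrict_iterate_totalD,
        EvolSystem.toPair]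
    · simp only [EvolSystem.timeD, mkDerivation_X, restrict_X_U, restrict_iterate_totalD]
      split_ifs with hj
      · simp [hj, EvolSystem.toPair]
      · simp [hS j hj, iterate_shiftD_zero]

theorem EvolSystem.IsSymmetryOf.toPair {S T : EvolSystem K N} (h : T.IsSymmetryOf S)
    (hS : ∀ j ≠ i, restrict i (S.vector j) = 0)
    (hT : ∀ j ≠ i, restrict i (T.vector j) = 0) (c : Bool) :
    flow 0 (S.toPair i) (T.toPair i c) = flow 0 (T.toPair i) (S.toPair i c) := by
  cases c
  · simpa [EvolSystem.toPair, restrict_timeD i hS, restrict_timeD i hT] using congrArg (restrict i) h.1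
  · simpa [EvolSystem.toPair, restrict_timeD i hS, restrict_timeD i hT] using congrArg (restrict i) (h.2 i)

theorem restrict_secondOrderSystem_vector (a : ℕ → K) (j : Fin N) (hj : j ≠ i) :
    restrict i ((secondOrderSystem N a).vector j) = 0 := by
  simp [secondOrderSystem, restrict_Ud, hj]

theorem restrict_thirdOrderSystem_vector (b : ℕ → K) (j : Fin N) (hj : j ≠ i) :
    restrict i ((thirdOrderSystem N b).vector j) = 0 := by
  simp [thirdOrderSystem, restrict_Ud, hj]

theorem HomogeneousAnsatz.restrict_toSystem_vector {μ : ℕ} (A : HomogeneousAnsatz K μ)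
    (j : Fin N) (hj : j ≠ i) : restrict i ((A.toSystem N).vector j) = 0 := by
  simp [HomogeneousAnsatz.toSystem, restrict_Ud, hj]

/-- Only `a 12` and `a 13` merge, and neither is a coupling coefficient. -/
theorem toPair_secondOrderSystem (a : ℕ → K) :
    (secondOrderSystem N a).toPair i = pairSystem (fun c => if c then a 8 else a 1)
      (![fun c => if c then a 12 + a 13 else a 2, fun c => if c then a 15 else a 3,
        fun c => if c then a 10 else a 4, fun c => if c then a 9 else a 5,
        fun c => if c then a 14 else a 6, fun c => if c then a 11 else a 7]) := by
  funext c
  cases c <;>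
  simp [EvolSystem.toPair, secondOrderSystem, pairSystem, restrict_ud, restrict_Ud, restrict_dotU] <;> ring

universe v

/-- An admissible second-order system has no symmetry of order three or four whose linear part is
diagonal and nonzero. -/
theorem not_isSymmetryOf_secondOrderSystem {K : Type v} [Field K] [CharZero K] {N : ℕ} (i : Fin N)
    {a : ℕ → K} (ha : SecondOrderAdmissible a) {T : EvolSystem K N} {μ : ℕ} (hμ : μ = 3 ∨ μ = 4)
    {β : Bool → K} (hβ : β false ≠ 0 ∨ β true ≠ 0)
    (hT : ∀ j ≠ i, restrict i (T.vector j) = 0)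
    (hlin : ∀ (R : Type v) [CommRing R] [Algebra K R] (c c' : Bool) (x : R),
      symb (map (algebraMap K R) (T.toPair i c)) [(c', x)]
        = if c = c' then algebraMap K R (β c) * x ^ μ else 0) :
    ¬ T.IsSymmetryOf (secondOrderSystem N a) := by
  intro h
  have hcomm := h.toPair i (restrict_secondOrderSystem_vector i a) hT
  rw [toPair_secondOrderSystem] at hcomm
  -- The resonance argument for one equation needs the second-order term of the other: `a 1 ≠ 0`
  -- decouples the vector equation, `a 8 ≠ 0` the scalar one.
  obtain ⟨hα | hα, h1, h2⟩ := ha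
  · obtain ⟨h3, h4, h5, h6⟩ := pairSystem_coeff_eq_zero (c := true) hμ (by simpa using hα)
      (by simpa using hβ.symm) hlin (hcomm true)
    change a 10 = 0 at h3
    change a 9 = 0 at h4
    change a 14 = 0 at h5
    change a 11 = 0 at h6
    tauto
  · obtain ⟨h3, h4, h5, h6⟩ := pairSystem_coeff_eq_zero (c := false) hμ (by simpa using hα)
      (by simpa using hβ) hlin (hcomm false)
    change a 4 = 0 at h3
    change a 5 = 0 at h4
    change a 6 = 0 at h5
    change a 7 = 0 at h6
    tauto

/-! ### Linear parts of the third- and fourth-order symmetries -/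

section LinearSymbols

variable (R : Type*) [CommRing R] [Algebra K R]

theorem symb_thirdOrderSystem (b : ℕ → K) (c c' : Bool) (x : R) :
    symb (map (algebraMap K R) ((thirdOrderSystem N b).toPair i c)) [(c', x)]
      = if c = c' then algebraMap K R (if c then b 17 else b 1) * x ^ 3 else 0 := by
  cases c <;> cases c' <;>
  simp [symb, EvolSystem.toPair, thirdOrderSystem, restrict_ud, restrict_Ud, restrict_dotU,
    Derivation.leibniz, pow_succ, algebraMap_eq]

theorem restrict_scalarEval_X (g : ScalarGen) :
    restrict (K := K) i (scalarEval N (X g)) = match g with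
      | .u k => X (false, k)
      | .dot m d => X (true, m) * X (true, m + d) := by
  cases g <;> simp [scalarEval, restrict_ud, restrict_dotU]

theorem constantCoeff_restrict_scalarEval (p : MvPolynomial ScalarGen K) :
    constantCoeff (restrict i (scalarEval N p)) = constantCoeff p := by
  induction p using MvPolynomial.induction_on with
  | C a => simp [← algebraMap_eq]
  | add p q hp hq => simp only [map_add, hp, hq]
  | mul_X p g hp =>
    rw [map_mul, map_mul, map_mul, map_mul, restrict_scalarEval_X]
    cases g <;> simp

/-- The linear symbol of the restriction of a scalar expression. -/
noncomputable def scalarSymb (m : Bool × R) (p : MvPolynomial ScalarGen K) : R :=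
  constantCoeff (modeD m (map (algebraMap K R) (restrict i (scalarEval N p))))

theorem scalarSymb_add (m : Bool × R) (p q : MvPolynomial ScalarGen K) :
    scalarSymb i R m (p + q) = scalarSymb i R m p + scalarSymb i R m q := by
  simp only [scalarSymb, map_add]

theorem scalarSymb_mul (m : Bool × R) (p q : MvPolynomial ScalarGen K) :
    scalarSymb i R m (p * q) = algebraMap K R (constantCoeff p) * scalarSymb i R m q
      + algebraMap K R (constantCoeff q) * scalarSymb i R m p := by
  simp only [scalarSymb, map_mul, Derivation.leibniz, map_add, smul_eq_mul, constantCoeff_map,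
    constantCoeff_restrict_scalarEval]

theorem scalarSymb_C (m : Bool × R) (r : K) : scalarSymb (N := N) i R m (C r) = 0 := by
  have h : restrict i (scalarEval N (C r)) = C r := by
    rw [← algebraMap_eq, AlgHom.commutes, AlgHom.commutes, algebraMap_eq]
  rw [scalarSymb, h, map_C, modeD_C, map_zero]

theorem scalarSymb_X_u (m : Bool × R) (k : ℕ) :
    scalarSymb (K := K) i R m (X (.u k)) = if false = m.1 then m.2 ^ k else 0 := by
  rw [scalarSymb, restrict_scalarEval_X, map_X, modeD_X]
  split_ifs <;> simp

theorem scalarSymb_X_dot (m : Bool × R) (k d : ℕ) :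
    scalarSymb (K := K) i R m (X (.dot k d)) = 0 := by
  simp only [scalarSymb, restrict_scalarEval_X, map_mul, map_X, Derivation.leibniz, map_add,
    smul_eq_mul, constantCoeff_X, zero_mul, add_zero]

/-- By `scalarSymb_mul`, products of two factors without constant term have no linear symbol, and a
scalar product of derivatives of `U` is already quadratic. -/
theorem scalarSymb_eq_zero (m : Bool × R) {p : MvPolynomial ScalarGen K}
    (hp : ∀ k, p.coeff (Finsupp.single (.u k) 1) = 0) : scalarSymb i R m p = 0 := by
  classical
  have hmon : ∀ s ∈ p.support, scalarSymb i R m (monomial s (p.coeff s)) = 0 := by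
    intro s hs
    rcases eq_or_ne s 0 with rfl | h0
    · exact scalarSymb_C i R m _
    obtain ⟨g, hg⟩ := Finsupp.support_nonempty_iff.2 h0
    obtain ⟨t, rfl⟩ : ∃ t, s = t + Finsupp.single g 1 :=
      ⟨s - Finsupp.single g 1, (tsub_add_cancel_of_le (Finsupp.single_le_iff.2
        (Nat.one_le_iff_ne_zero.2 (Finsupp.mem_support_iff.1 hg)))).symm⟩
    rw [monomial_add_single, pow_one, scalarSymb_mul, constantCoeff_X, map_zero, zero_mul, add_zero]
    rcases eq_or_ne t 0 with rfl | ht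
    · cases g with
      | u k => rw [zero_add] at hs; exact absurd (hp k) (mem_support_iff.1 hs)
      | dot k d => rw [scalarSymb_X_dot, mul_zero]
    · rw [constantCoeff_monomial, if_neg ht, map_zero, zero_mul]
  let F : MvPolynomial ScalarGen K →+ R := ⟨⟨scalarSymb i R m, by
    simpa using scalarSymb_C (N := N) i R m (0 : K)⟩, scalarSymb_add i R m⟩
  change F p = 0
  rw [p.as_sum, map_sum]
  exact Finset.sum_eq_zero hmon

theorem scalarSymb_of_isWeightedHomogeneous (m : Bool × R) {p : MvPolynomial ScalarGen K} {μ : ℕ}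
    (hp : IsWeightedHomogeneous ScalarGen.twiceWeight p (2 * μ + 1)) :
    scalarSymb i R m p = if false = m.1 then
      algebraMap K R (p.coeff (Finsupp.single (.u μ) 1)) * m.2 ^ μ else 0 := by
  classical
  have h := scalarSymb_eq_zero (N := N) i R m
    (p := p - C (p.coeff (Finsupp.single (.u μ) 1)) * X (.u μ)) fun k => by
      rw [coeff_sub, coeff_C_mul, coeff_X]
      rcases eq_or_ne μ k with rfl | hk
      · simp
      · have h1 : p.coeff (Finsupp.single (.u k) 1) = 0 := by
          by_contra h0
          have := hp h0
          simp [Finsupp.weight_single, ScalarGen.twiceWeight] at this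
          exact hk this.symm
        have h2 : Finsupp.single (ScalarGen.u μ) 1 ≠ Finsupp.single (ScalarGen.u k) 1 := by
          intro h
          have := Finsupp.single_left_injective one_ne_zero h
          simp at this
          exact hk this
        rw [h1, if_neg h2, mul_zero, sub_zero]
  have h' := scalarSymb_add i R m
    (p - C (p.coeff (Finsupp.single (.u μ) 1)) * X (.u μ))
    (C (p.coeff (Finsupp.single (.u μ) 1)) * X (.u μ))
  rw [sub_add_cancel, h, scalarSymb_mul, scalarSymb_X_u, scalarSymb_C] at h'
  simpa using h'

theorem HomogeneousAnsatz.symb_toSystem {μ : ℕ} (A : HomogeneousAnsatz K μ) (c c' : Bool) (x : R) :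
    symb (map (algebraMap K R) ((A.toSystem N).toPair i c)) [(c', x)]
      = if c = c' then algebraMap K R (if c then (A.vector (Fin.last μ)).coeff 0 else
          A.scalar.coeff (Finsupp.single (.u μ) 1)) * x ^ μ else 0 := by
  cases c
  · exact scalarSymb_of_isWeightedHomogeneous i R (c', x) A.scalar_hom
  -- The linear part of the vector equation sees only the constant terms of its coefficients; by
  -- weight, only the top coefficient can have one.
  · have h : ∀ k : Fin (μ + 1), k ≠ Fin.last μ → constantCoeff (A.vector k) = 0 := by
      intro k hk
      by_contra h0
      have h1 := A.vector_hom k h0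
      have h2 : (k : ℕ) < μ := Fin.val_lt_last hk
      simp at h1
      omega
    have h' : ∑ k : Fin (μ + 1), (if true = c' then
        algebraMap K R (constantCoeff (A.vector k)) * x ^ (k : ℕ) else 0)
        = if true = c' then algebraMap K R (constantCoeff (A.vector (Fin.last μ))) * x ^ μ else 0 := by
      rw [Finset.sum_eq_single (Fin.last μ)]
      · simp
      · intro k _ hk
        simp [h k hk]
      · simp
    simp only [constantCoeff_eq] at h'
    simp only [symb, EvolSystem.toPair, HomogeneousAnsatz.toSystem, if_true, List.foldl, map_sum]
    refine Eq.trans (Finset.sum_congr rfl fun k _ => ?_) h'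
    rw [← constantCoeff_eq]
    rw [map_mul, map_mul, restrict_Ud, if_pos rfl, map_X, Derivation.leibniz, map_add,
      smul_eq_mul, smul_eq_mul, map_mul, map_mul, constantCoeff_X, zero_mul, add_zero,
      constantCoeff_map, constantCoeff_restrict_scalarEval, modeD_X]
    split_ifs <;> simp

end LinearSymbols

end Reduction

theorem mainTheorem10 (K : Type*) [Field K] [CharZero K] (N : ℕ) (hN : 0 < N)
    (a : ℕ → K) (ha : SecondOrderAdmissible a) :
    (¬ ∃ b : ℕ → K, ThirdOrderAdmissible b ∧
        (thirdOrderSystem N b).IsSymmetryOf (secondOrderSystem N a)) ∧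
      (¬ ∃ A : HomogeneousAnsatz K 4, A.Admissible ∧
        (A.toSystem N).IsSymmetryOf (secondOrderSystem N a)) := by
  let i : Fin N := ⟨0, hN⟩
  constructor
  · rintro ⟨b, hb, h⟩
    exact not_isSymmetryOf_secondOrderSystem i ha (.inl rfl)
      (β := fun c => if c then b 17 else b 1) (by simpa using hb.1)
      (restrict_thirdOrderSystem_vector i b) (fun R _ _ => symb_thirdOrderSystem i R b) h
  · rintro ⟨A, hA, h⟩
    exact not_isSymmetryOf_secondOrderSystem i ha (.inr rfl)
      (β := fun c => if c then (A.vector (Fin.last 4)).coeff 0 else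
        A.scalar.coeff (Finsupp.single (.u 4) 1)) (by simpa using hA.1)
      (A.restrict_toSystem_vector i) (fun R _ _ => A.symb_toSystem i R) h
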